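/- All graphs are finite and simple. A \emph{queue layout} of a graph $G$ with $k$ queues consists of a linear order $\prec$ of the vertices of $G$ and a partition of the edges of $G$ into $k$ (possibly empty) classes, called queues, such that no queue contains two nested edges, that is, edges $ab$ and $cd$ with $a \prec c \prec d \prec b$. The \emph{queue number} of $G$ is the smallest $k$ for which $G$ has a queue layout with $k$ queues. A \emph{planar 3-tree} is a triangulated plane graph $G$ (every face, including the outer face, is bounded by a triangle) with $n \ge 3$ vertices such that either $n = 3$ and $G$ is a 3-cycle, or $n > 3$ and $G$ has a vertex whose deletion gives a planar 3-tree with $n-1$ vertices. \textbf{Theorem.} Every planar 3-tree has queue number at most $5$. -/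

import Mathlib

universe u

namespace SimpleGraph

/-- A combinatorial embedding of `G` in an oriented surface: `next` sends a dart (oriented edge)
to the next dart in clockwise order around the same source vertex. The cycles of `next` are
exactly the sets of darts with a common source. -/
structure RotationSystem {V : Type u} (G : SimpleGraph V) where
  next : Equiv.Perm G.Dart
  sameCycle_iff : ∀ d e : G.Dart, next.SameCycle d e ↔ d.fst = e.fst

namespace RotationSystem

variable {V : Type u} {G : SimpleGraph V}

/-- The step along the boundary walk of a face: traverse the dart `u → v`, then leave `v` by the
dart that follows `v → u` in the rotation at `v`. -/
def faceNext (R : RotationSystem G) : Equiv.Perm G.Dart :=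
  (Dart.symm_involutive (G := G)).toPerm.trans R.next

/-- The faces of the embedding of a graph without isolated vertices: the orbits of `faceNext`. -/
def Face (R : RotationSystem G) : Type u :=
  Quotient (Equiv.Perm.SameCycle.setoid R.faceNext)

/-- The embedding of a (finite, connected, with an edge) graph is an embedding in the sphere,
equivalently in the plane: Euler's formula `|V| - |E| + |F| = 2` holds, i.e. the genus is `0`. -/
def IsPlane (R : RotationSystem G) : Prop :=
  G.Connected ∧ (Nat.card V : ℤ) - (Nat.card G.edgeSet : ℤ) + (Nat.card R.Face : ℤ) = 2

/-- Every face (the outer one included) is bounded by a closed walk of length `3`. -/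
def IsTriangulated (R : RotationSystem G) : Prop :=
  ∀ d : G.Dart, Function.minimalPeriod R.faceNext d = 3

end RotationSystem

/-- `G` is a finite graph with at least three vertices that can be embedded in the plane as a
triangulated plane graph. -/
def IsPlaneTriangulation {V : Type u} (G : SimpleGraph V) : Prop :=
  3 ≤ Nat.card V ∧ ∃ R : RotationSystem G, R.IsPlane ∧ R.IsTriangulated

/-- A planar 3-tree is a triangulated plane graph with `n ≥ 3` vertices that is a 3-cycle if
`n = 3`, and that has a vertex whose deletion gives a planar 3-tree if `n > 3`.
(The 3-cycle is a triangulated plane graph, so this need not be demanded in the first case.) -/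
inductive IsPlanarThreeTree : {V : Type u} → SimpleGraph V → Prop
  | triangle {V : Type u} (G : SimpleGraph V) (card_eq : Nat.card V = 3) (eq_top : G = ⊤) :
      IsPlanarThreeTree G
  | step {V : Type u} (G : SimpleGraph V) (lt_card : 3 < Nat.card V)
      (triangulation : G.IsPlaneTriangulation) (v : V)
      (delete : IsPlanarThreeTree (G.induce ({v}ᶜ : Set V))) :
      IsPlanarThreeTree G

/-- A `k`-queue layout of `G`: a linear order of the vertices and a partition of the edges into
`k` (possibly empty) queues such that no two edges of the same queue are nested. Edges `ab` and
`cd` with `a < c < d < b` are nested (and have no common endvertex). -/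
structure QueueLayout {V : Type u} (G : SimpleGraph V) (k : ℕ) where
  order : LinearOrder V
  queue : G.edgeSet → Fin k
  not_nested : ∀ (a b c d : V) (hab : G.Adj a b) (hcd : G.Adj c d),
    order.lt a c → order.lt c d → order.lt d b →
      queue ⟨s(a, b), hab⟩ ≠ queue ⟨s(c, d), hcd⟩

/-- The smallest number of queues in a queue layout of `G` (`⊤` if no finite number suffices). -/
noncomputable def queueNumber {V : Type u} (G : SimpleGraph V) : ℕ∞ :=
  ⨅ (k : ℕ) (_ : Nonempty (QueueLayout G k)), (k : ℕ∞)

end SimpleGraph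

/-!
Write the vertices of a planar 3-tree in nested layers: the vertices stacked into a face that are
adjacent to one of its corners form a component, and the components of the next layer lie in the
faces of this component. A component can be drawn on levels such that each of its faces has one
corner on each of three consecutive levels, and such that the faces with the same lowest level are
ordered from left to right, consistently with each of their three corners. Order the vertices by
layer, then by the surrounding faces, then by level and position. An edge inside a component joins
the lowest corner of a face to its second or third corner, which gives two queues; an edge between
components joins the `i`-th corner of a face to a vertex of the component inside, which gives three
more. In each queue the order of the lower ends determines the order of the faces, and this excludes
nested edges.

All choices can be made in advance: there is an infinite graph with such a layout in which every
triangle that may become a face has an inexhaustible supply of vertices inside, so that every planar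
3-tree embeds by stacking one vertex after another. By Euler's formula the vertex deleted from a
planar 3-tree has degree three, so its neighbours bound a face of the triangulation that remains.
-/

open SimpleGraph
open scoped Function

namespace PlanarThreeTree

section QueueLayout

variable {V W : Type*} {G : SimpleGraph V} {H : SimpleGraph W} {k : ℕ}

/-- The restriction of a queue layout to a subgraph. -/
def queueLayoutOfCopy (f : Copy G H) (L : H.QueueLayout k) : G.QueueLayout k :=
  letI := L.order
  { order := LinearOrder.lift' f f.injective
    queue := fun e ↦ L.queue (f.toHom.mapEdgeSet e)
    not_nested := fun a b c d hab hcd ↦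
      L.not_nested (f a) (f b) (f c) (f d) (f.toHom.map_adj hab) (f.toHom.map_adj hcd) }

theorem queueNumber_le_of_isContained (hGH : G ⊑ H) (hH : Nonempty (H.QueueLayout k)) :
    G.queueNumber ≤ k :=
  iInf₂_le k (hGH.elim fun f ↦ hH.map (queueLayoutOfCopy f))

theorem nonempty_queueLayout {α ι : Type*} [LinearOrder α] [Fintype ι] (r : V → α)
    (hr : Function.Injective r) (Q : ι → V → V → Prop) (hlt : ∀ {q a b}, Q q a b → r a < r b)
    (hnest : ∀ {q a b c d}, Q q a b → Q q c d → r a < r c → ¬ r d < r b)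
    (hadj : ∀ {a b}, G.Adj a b → ∃ q, Q q a b ∨ Q q b a) :
    Nonempty (G.QueueLayout (Fintype.card ι)) := by
  have hqueue (e : G.edgeSet) : ∃ q, ∀ a b, (e : Sym2 V) = s(a, b) → r a < r b → Q q a b := by
    obtain ⟨e, he⟩ := e
    induction e with | _ u w => ?_
    obtain ⟨q, hq⟩ := hadj he
    refine ⟨q, fun a b hab hlt' ↦ ?_⟩
    obtain ⟨rfl, rfl⟩ | ⟨rfl, rfl⟩ := Sym2.eq_iff.1 hab
    · exact hq.resolve_right fun h ↦ lt_asymm (hlt h) hlt'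
    · exact hq.resolve_left fun h ↦ lt_asymm (hlt h) hlt'
  choose queue hqueue using hqueue
  refine ⟨LinearOrder.lift' r hr, fun e ↦ Fintype.equivFin ι (queue e),
    fun a b c d hab hcd (hac : r a < r c) (hlt_cd : r c < r d) (hdb : r d < r b) heq ↦ ?_⟩
  have hQ := hqueue ⟨_, hab⟩ a b rfl (hac.trans (hlt_cd.trans hdb))
  rw [(Fintype.equivFin ι).injective heq] at hQ
  exact hnest hQ (hqueue ⟨_, hcd⟩ c d rfl hlt_cd) hac hdb

end QueueLayout

section StackingSystem

variable {α : Type*} (H : SimpleGraph α)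

/-- A vertex `n` of `S` is adjacent to the corners `c` of a triangle and splits it into three
triangles of type `P`, the `i`-th of which is opposite to the corner `c i`. Here `P a b c S` is to
be read as: all vertices inside the triangle `a b c` can be taken from `S`. -/
def Splits (P : α → α → α → Set α → Prop) (c : Fin 3 → α) (S : Set α) : Prop :=
  ∃ n ∈ S, (∀ i, H.Adj n (c i)) ∧ ∃ T : Fin 3 → Set α, Pairwise (Disjoint on T) ∧
    ∀ i, T i ⊆ S \ {n} ∧ P n (c (i + 1)) (c (i + 2)) (T i)

/-- The triangles of type `P` can be split over and over again, and some triangle of `H` has this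
property on both of its sides. -/
structure IsStackingSystem (P : α → α → α → Set α → Prop) : Prop where
  rotate {a b c : α} {S : Set α} : P a b c S → P b c a S
  splits {c : Fin 3 → α} {S : Set α} : P (c 0) (c 1) (c 2) S → Splits H P c S
  exists_triangle : ∃ (c : Fin 3 → α) (S T : Set α), (Pairwise fun i j ↦ H.Adj (c i) (c j)) ∧
    P (c 0) (c 1) (c 2) S ∧ P (c 0) (c 2) (c 1) T ∧ Disjoint S T ∧ ∀ i, c i ∉ S ∧ c i ∉ T

end StackingSystem

section SameCycle

variable {α : Type*} (f : Equiv.Perm α)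

theorem ncard_setOf_sameCycle [Finite α] (x : α) :
    {y | f.SameCycle x y}.ncard = Function.minimalPeriod f x := by
  have := Fintype.ofFinite (MulAction.orbit (Subgroup.zpowers f) x)
  have horbit : {y | f.SameCycle x y} = MulAction.orbit (Subgroup.zpowers f) x := by
    ext y
    simp [MulAction.mem_orbit_iff, Equiv.Perm.SameCycle, Subgroup.smul_def]
  rw [horbit, ← Nat.card_coe_set_eq, Nat.card_eq_fintype_card, ← MulAction.minimalPeriod_eq_card]
  rfl

theorem card_eq_mul_card_quotient_sameCycle [Finite α] {n : ℕ}
    (h : ∀ x, Function.minimalPeriod f x = n) :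
    Nat.card α = n * Nat.card (Quotient (Equiv.Perm.SameCycle.setoid f)) := by
  have hfiber (q : Quotient (Equiv.Perm.SameCycle.setoid f)) :
      Nat.card {x // Quotient.mk _ x = q} = n := by
    induction q using Quotient.inductionOn with | _ x =>
    rw [← h x, ← ncard_setOf_sameCycle, ← Nat.card_coe_set_eq]
    exact Nat.card_congr <| Equiv.subtypeEquivRight fun y ↦
      Quotient.eq.trans Equiv.Perm.sameCycle_comm
  have := Fintype.ofFinite (Quotient (Equiv.Perm.SameCycle.setoid f))
  rw [← Nat.card_congr (Equiv.sigmaFiberEquiv (Quotient.mk (Equiv.Perm.SameCycle.setoid f))),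
    Nat.card_sigma, Finset.sum_congr rfl fun q _ ↦ hfiber q]
  simp [mul_comm]

end SameCycle

section Degree

variable {V : Type u} {G : SimpleGraph V}

theorem card_dart_eq_two_mul_card_edgeSet [Finite V] :
    Nat.card G.Dart = 2 * Nat.card G.edgeSet := by
  classical
  have := Fintype.ofFinite V
  rw [Nat.card_eq_fintype_card, G.dart_card_eq_twice_card_edges, edgeFinset_card,
    Nat.card_eq_fintype_card]

theorem card_edgeSet_of_isPlaneTriangulation (h : G.IsPlaneTriangulation) :
    Nat.card G.edgeSet + 6 = 3 * Nat.card V := by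
  obtain ⟨hcard, R, ⟨-, heuler⟩, hR⟩ := h
  have : Finite V := Nat.finite_of_card_ne_zero (by lia)
  have : Finite G.Dart := .of_injective _ Dart.toProd_injective
  have hfaces : Nat.card G.Dart = 3 * Nat.card R.Face := card_eq_mul_card_quotient_sameCycle _ hR
  rw [card_dart_eq_two_mul_card_edgeSet] at hfaces
  lia

theorem three_le_card_of_isPlanarThreeTree (h : G.IsPlanarThreeTree) : 3 ≤ Nat.card V := by
  cases h <;> lia

theorem card_edgeSet_of_isPlanarThreeTree (h : G.IsPlanarThreeTree) :
    Nat.card G.edgeSet + 6 = 3 * Nat.card V := by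
  classical
  cases h with
  | triangle _ hcard htop =>
    have : Finite V := Nat.finite_of_card_ne_zero (by lia)
    have := Fintype.ofFinite V
    subst htop
    rw [Nat.card_eq_fintype_card, ← edgeFinset_card, card_edgeFinset_top_eq_card_choose_two,
      ← Nat.card_eq_fintype_card, hcard]
    rfl
  | step _ _ htri => exact card_edgeSet_of_isPlaneTriangulation htri

theorem card_edgeSet_induce_compl_singleton [Finite V] (v : V) :
    Nat.card (G.induce ({v}ᶜ : Set V)).edgeSet + (G.neighborSet v).ncard =
      Nat.card G.edgeSet := by
  classical
  have := Fintype.ofFinite V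
  have hle : G.degree v ≤ G.edgeFinset.card :=
    G.card_incidenceFinset_eq_degree v ▸ Finset.card_le_card (G.incidenceFinset_subset v)
  have hdegree : (G.neighborSet v).ncard = G.degree v := by
    rw [Set.ncard_eq_toFinset_card', ← neighborFinset, card_neighborFinset_eq_degree]
  rw [hdegree, Nat.card_eq_fintype_card, Nat.card_eq_fintype_card, ← edgeFinset_card,
    ← edgeFinset_card, card_edgeFinset_induce_compl_singleton,
    card_edgeFinset_deleteIncidenceSet, Nat.sub_add_cancel hle]

theorem ncard_neighborSet_of_isPlanarThreeTree {v : V} (h : G.IsPlanarThreeTree)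
    (h' : (G.induce ({v}ᶜ : Set V)).IsPlanarThreeTree) : (G.neighborSet v).ncard = 3 := by
  have hV := three_le_card_of_isPlanarThreeTree h
  have : Finite V := Nat.finite_of_card_ne_zero (by lia)
  have hcompl : Nat.card ({v}ᶜ : Set V) + 1 = Nat.card V := by
    rw [Nat.card_coe_set_eq, ← Set.ncard_singleton v, add_comm, Set.ncard_add_ncard_compl]
  have hG := card_edgeSet_of_isPlanarThreeTree h
  have hG' := card_edgeSet_of_isPlanarThreeTree h'
  have hdelete := card_edgeSet_induce_compl_singleton (G := G) v
  lia

end Degree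

section Triangle

variable {V W : Type*}

theorem cycleMap_injective {f : V → W} (hf : f.Injective) : (Cycle.map f).Injective := by
  rintro ⟨l⟩ ⟨l'⟩ h
  obtain ⟨n, hn⟩ := Cycle.coe_eq_coe.1 h
  rw [← List.map_rotate] at hn
  exact Cycle.coe_eq_coe.2 ⟨n, hf.list_map hn⟩

/-- The triangle with corners `a`, `b`, `c` in this cyclic order. -/
def triangle (a b c : V) : Cycle V := ↑[a, b, c]

theorem mem_triangle {a b c x : V} : x ∈ triangle a b c ↔ x = a ∨ x = b ∨ x = c := by
  simp [triangle]

theorem map_triangle (f : V → W) (a b c : V) :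
    (triangle a b c).map f = triangle (f a) (f b) (f c) := rfl

theorem triangle_rotate (a b c : V) : triangle b c a = triangle a b c :=
  Cycle.coe_eq_coe.2 (List.IsRotated.symm ⟨1, rfl⟩)

theorem triangle_eq_iff {a b c a' b' c' : V} : triangle a b c = triangle a' b' c' ↔
    a = a' ∧ b = b' ∧ c = c' ∨ a = b' ∧ b = c' ∧ c = a' ∨ a = c' ∧ b = a' ∧ c = b' := by
  rw [triangle, triangle, Cycle.coe_eq_coe, ← List.mem_cyclicPermutations_iff]
  simp [List.cyclicPermutations]

theorem of_triangle_eq {p : V → V → V → Prop} (hp : ∀ {a b c}, p a b c → p b c a)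
    {a b c a' b' c' : V} (h : triangle a b c = triangle a' b' c') (habc : p a b c) :
    p a' b' c' := by
  obtain ⟨rfl, rfl, rfl⟩ | ⟨rfl, rfl, rfl⟩ | ⟨rfl, rfl, rfl⟩ := triangle_eq_iff.1 h
  exacts [habc, hp (hp habc), hp habc]

theorem triangle_ne_map {v : V} (a b : V) (f : Cycle ({v}ᶜ : Set V)) :
    triangle v a b ≠ f.map Subtype.val := by
  intro h
  obtain ⟨u, -, hu⟩ := Cycle.mem_map.1 (h ▸ mem_triangle.2 (.inl rfl) : v ∈ f.map Subtype.val)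
  exact u.2 hu

end Triangle

/-- A triangulation of a closed oriented surface with the edges of `G` as edges: every dart `ab`
lies on the boundary of exactly one face `abc`. The faces around a vertex need not form a single
cycle. -/
structure OrientedTriangulation {V : Type*} (G : SimpleGraph V) where
  IsFace : V → V → V → Prop
  adj {a b c : V} : IsFace a b c → G.Adj a b
  rotate {a b c : V} : IsFace a b c → IsFace b c a
  exists_isFace {a b : V} : G.Adj a b → ∃ c, IsFace a b c
  unique {a b c c' : V} : IsFace a b c → IsFace a b c' → c = c'

theorem fst_next {V : Type u} {G : SimpleGraph V} (R : G.RotationSystem) (d : G.Dart) :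
    (R.next d).fst = d.fst :=
  ((R.sameCycle_iff d (R.next d)).1 ⟨1, by simp⟩).symm

theorem fst_faceNext {V : Type u} {G : SimpleGraph V} (R : G.RotationSystem) (d : G.Dart) :
    (R.faceNext d).fst = d.snd :=
  fst_next R d.symm

namespace OrientedTriangulation

section Constructions

variable {V : Type u} {G : SimpleGraph V}

/-- The faces of a triangulated embedding. -/
def ofRotationSystem (R : G.RotationSystem) (hR : R.IsTriangulated) : OrientedTriangulation G where
  IsFace a b c := ∃ h : G.Adj a b, (R.faceNext ⟨(a, b), h⟩).snd = c
  adj h := h.1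
  rotate := by
    rintro a b c ⟨h, rfl⟩
    set d : G.Dart := ⟨(a, b), h⟩
    have hfst : (R.faceNext d).fst = b := fst_faceNext R d
    have hnext : R.faceNext (R.faceNext (R.faceNext d)) = d := by
      simpa [hR d, Function.IsPeriodicPt, Function.IsFixedPt] using
        Function.isPeriodicPt_minimalPeriod R.faceNext d
    refine ⟨hfst ▸ (R.faceNext d).adj, ?_⟩
    have hdart : (⟨(b, (R.faceNext d).snd), hfst ▸ (R.faceNext d).adj⟩ : G.Dart) =
        R.faceNext d := Dart.ext _ _ (Prod.ext hfst.symm rfl)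
    rw [hdart, ← fst_faceNext, hnext]
  exists_isFace h := ⟨_, h, rfl⟩
  unique := by
    rintro a b c c' ⟨h, rfl⟩ ⟨-, rfl⟩
    rfl

/-- The two sides of a triangle. -/
def ofEquivFinThree (φ : V ≃ Fin 3) : OrientedTriangulation (⊤ : SimpleGraph V) where
  IsFace a b c := a ≠ b ∧ b ≠ c ∧ c ≠ a
  adj h := h.1
  rotate h := ⟨h.2.1, h.2.2, h.1⟩
  exists_isFace {a b} h := by
    have hthird : ∀ i j : Fin 3, i ≠ j → ∃ k, j ≠ k ∧ k ≠ i := by decide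
    obtain ⟨k, hk⟩ := hthird (φ a) (φ b) (φ.injective.ne h)
    exact ⟨φ.symm k, h, by grind⟩
  unique {a b c c'} h h' := by
    have hthird : ∀ i j k l : Fin 3, i ≠ j → j ≠ k → k ≠ i → j ≠ l → l ≠ i → k = l := by decide
    exact φ.injective (hthird (φ a) (φ b) (φ c) (φ c') (by simpa using h.1) (by simpa using h.2.1)
      (by simpa using h.2.2) (by simpa using h'.2.1) (by simpa using h'.2.2))

end Constructions

variable {V : Type*} {G : SimpleGraph V} (T : OrientedTriangulation G)

/-- The neighbours of `v` are `x 0`, `x 1`, `x 2`, in the cyclic order that is given by the faces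
at `v`. -/
structure IsLink (v : V) (x : Fin 3 → V) : Prop where
  injective : x.Injective
  adj_iff (w : V) : G.Adj v w ↔ ∃ i, w = x i
  isFace (i : Fin 3) : T.IsFace v (x i) (x (i + 1))

theorem exists_isLink {v : V} (hv : (G.neighborSet v).ncard = 3) : ∃ x, T.IsLink v x := by
  have : Finite (G.neighborSet v) := Set.finite_of_ncard_ne_zero (by lia)
  let y : Fin 3 ≃ G.neighborSet v :=
    (Finite.equivFinOfCardEq ((Nat.card_coe_set_eq _).trans hv)).symm
  have hy (i : Fin 3) : ∃ j, T.IsFace v (y i) (y j) := by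
    obtain ⟨c, hc⟩ := T.exists_isFace (y i).2
    exact ⟨y.symm ⟨c, (T.adj (T.rotate (T.rotate hc))).symm⟩, by simpa⟩
  choose σ hσ using hy
  have hinj : σ.Injective := fun i j hij ↦ y.injective <| Subtype.ext <|
    T.unique (T.rotate (T.rotate (hσ i))) (hij ▸ T.rotate (T.rotate (hσ j)))
  have hne (i : Fin 3) : σ i ≠ i := fun h ↦ (T.adj (T.rotate (hσ i))).ne (by rw [h])
  obtain ⟨τ, hτ⟩ : ∃ τ : Equiv.Perm (Fin 3), ∀ i, σ (τ i) = τ (i + 1) := by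
    clear hσ
    revert σ
    decide
  refine ⟨fun i ↦ y (τ i), Subtype.val_injective.comp (y.injective.comp τ.injective),
    fun w ↦ ⟨fun hw ↦ ⟨τ.symm (y.symm ⟨w, hw⟩), by simp⟩, ?_⟩, fun i ↦ hτ i ▸ hσ (τ i)⟩
  rintro ⟨i, rfl⟩
  exact (y (τ i)).2

variable {T}

namespace IsLink

variable {v : V} {x : Fin 3 → V} (hx : T.IsLink v x)
include hx

theorem adj (i : Fin 3) : G.Adj v (x i) := (hx.adj_iff _).2 ⟨i, rfl⟩

theorem isFace_iff {a b : V} : T.IsFace v a b ↔ ∃ i, a = x i ∧ b = x (i + 1) := by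
  refine ⟨fun h ↦ ?_, ?_⟩
  · obtain ⟨i, rfl⟩ := (hx.adj_iff a).1 (T.adj h)
    exact ⟨i, rfl, T.unique h (hx.isFace i)⟩
  · rintro ⟨i, rfl, rfl⟩
    exact hx.isFace i

theorem isFace_rotate (i : Fin 3) : T.IsFace (x i) (x (i + 1)) v := T.rotate (hx.isFace i)

theorem not_isFace {a : V} (ha : a ≠ v) (i : Fin 3) : ¬ T.IsFace (x i) (x (i + 1)) a :=
  fun h ↦ ha (T.unique h (hx.isFace_rotate i))

/-- Deletes a vertex of degree three, which merges the three faces at this vertex. -/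
def delete : OrientedTriangulation (G.induce ({v}ᶜ : Set V)) where
  IsFace a b c := T.IsFace a b c ∨ ∃ i, (a : V) = x i ∧ (b : V) = x (i + 1) ∧ (c : V) = x (i + 2)
  adj := by
    rintro a b c (h | ⟨i, ha, hb, -⟩)
    · exact T.adj h
    · exact T.adj (ha ▸ hb ▸ hx.isFace_rotate i)
  rotate := by
    rintro a b c (h | ⟨i, ha, hb, hc⟩)
    · exact .inl (T.rotate h)
    · have h2 : i + 1 + 1 = i + 2 := by lia
      have h3 : i + 1 + 2 = i := by lia
      exact .inr ⟨i + 1, hb, by rw [h2, hc], by rw [h3, ha]⟩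
  exists_isFace := by
    rintro a b hab
    obtain ⟨c, hc⟩ := T.exists_isFace hab
    by_cases hcv : c = v
    · obtain ⟨i, ha, hb⟩ := hx.isFace_iff.1 (T.rotate (T.rotate (hcv ▸ hc)))
      exact ⟨⟨x (i + 2), (hx.adj _).ne'⟩, .inr ⟨i, ha, hb, rfl⟩⟩
    · exact ⟨⟨c, hcv⟩, .inl hc⟩
  unique := by
    have hne {a b c : ({v}ᶜ : Set V)} {i : Fin 3} (h : T.IsFace a b c) (ha : (a : V) = x i)
        (hb : (b : V) = x (i + 1)) : False :=
      hx.not_isFace c.2 i (ha ▸ hb ▸ h)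
    rintro a b c c' (h | ⟨i, ha, hb, hc⟩) (h' | ⟨i', ha', hb', hc'⟩)
    · exact Subtype.ext (T.unique h h')
    · exact (hne h ha' hb').elim
    · exact (hne h' ha hb).elim
    · rw [ha] at ha'
      rw [hx.injective ha', ← hc'] at hc
      exact Subtype.ext hc

theorem isFace_cases {a b c : V} (h : T.IsFace a b c) :
    (∃ i, triangle a b c = triangle v (x (i + 1)) (x (i + 2))) ∨
      ∃ a' b' c' : ({v}ᶜ : Set V), a = a' ∧ b = b' ∧ c = c' := by
  have hstar {b c : V} (h : T.IsFace v b c) :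
      ∃ i, triangle v b c = triangle v (x (i + 1)) (x (i + 2)) := by
    obtain ⟨i, rfl, rfl⟩ := hx.isFace_iff.1 h
    have h1 : i + 2 + 1 = i := by lia
    have h2 : i + 2 + 2 = i + 1 := by lia
    exact ⟨i + 2, by rw [h1, h2]⟩
  by_cases ha : a = v
  · exact .inl (ha ▸ hstar (ha ▸ h))
  by_cases hb : b = v
  · exact .inl (triangle_rotate a b c ▸ hb ▸ hstar (hb ▸ T.rotate h))
  by_cases hc : c = v
  · exact .inl (triangle_rotate c a b ▸ hc ▸ hstar (hc ▸ T.rotate (T.rotate h)))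
  exact .inr ⟨⟨a, ha⟩, ⟨b, hb⟩, ⟨c, hc⟩, rfl, rfl, rfl⟩

theorem triangle_injective :
    Function.Injective fun i : Fin 3 ↦ triangle v (x (i + 1)) (x (i + 2)) := by
  intro i j hij
  obtain ⟨-, h, -⟩ | ⟨h, -⟩ | ⟨h, -⟩ := triangle_eq_iff.1 hij
  · exact add_right_cancel (hx.injective h)
  · exact ((hx.adj _).ne h).elim
  · exact ((hx.adj _).ne h).elim

end IsLink

end OrientedTriangulation

section Stacking

variable {α : Type*} {V : Type*} {G : SimpleGraph V} {H : SimpleGraph α}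
  {P : α → α → α → Set α → Prop}

theorem exists_copy_extend {v : V} (g : Copy (G.induce ({v}ᶜ : Set V)) H) {n : α}
    (hn : ∀ u, g u ≠ n) (hadj : ∀ u : ({v}ᶜ : Set V), G.Adj v u → H.Adj n (g u)) :
    ∃ f : Copy G H, f v = n ∧ ∀ u : ({v}ᶜ : Set V), f u = g u := by
  classical
  let f (u : V) : α := if hu : u = v then n else g ⟨u, hu⟩
  have hfv : f v = n := dif_pos rfl
  have hf (u : ({v}ᶜ : Set V)) : f u = g u := dif_neg u.2
  have hcases (u : V) : u = v ∨ ∃ u' : ({v}ᶜ : Set V), u = u' :=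
    (em (u = v)).imp_right fun hu ↦ ⟨⟨u, hu⟩, rfl⟩
  have hfadj {a b : V} (hab : G.Adj a b) : H.Adj (f a) (f b) := by
    obtain rfl | ⟨a, rfl⟩ := hcases a <;> obtain rfl | ⟨b, rfl⟩ := hcases b
    · exact (G.irrefl hab).elim
    · exact hfv ▸ hf b ▸ hadj b hab
    · exact hfv ▸ hf a ▸ (hadj a hab.symm).symm
    · exact hf a ▸ hf b ▸ g.toHom.map_adj hab
  have hinj : f.Injective := fun a b hab ↦ by
    obtain rfl | ⟨a, rfl⟩ := hcases a <;> obtain rfl | ⟨b, rfl⟩ := hcases b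
    · rfl
    · exact (hn b (by rw [← hf, ← hab, hfv])).elim
    · exact (hn a (by rw [← hf, hab, hfv])).elim
    · exact congrArg Subtype.val (g.injective (by rwa [hf, hf] at hab))
  exact ⟨Hom.toCopy ⟨f, hfadj⟩ hinj, hfv, hf⟩

/-- A copy of `G` in `H` together with disjoint supplies of further vertices of `H` for the faces
of a triangulation. -/
structure Stacking (T : OrientedTriangulation G) (H : SimpleGraph α)
    (P : α → α → α → Set α → Prop) where
  vertex : Copy G H
  region : Cycle V → Set α
  disjoint : Pairwise (Disjoint on region)
  notMem_region (u : V) (f : Cycle V) : vertex u ∉ region f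
  isRegion {a b c : V} (h : T.IsFace a b c) :
    P (vertex a) (vertex b) (vertex c) (region (triangle a b c))

theorem nonempty_stacking_top (hP : IsStackingSystem H P) (φ : V ≃ Fin 3)
    (T : OrientedTriangulation (⊤ : SimpleGraph V)) : Nonempty (Stacking T H P) := by
  obtain ⟨c, S, S', hadj, hS, hS', hSS', hc⟩ := hP.exists_triangle
  have hne : triangle (0 : Fin 3) 1 2 ≠ triangle 0 2 1 := by simp [triangle_eq_iff]
  have horient : ∀ i j k : Fin 3, i ≠ j → j ≠ k → k ≠ i →
      triangle i j k = triangle 0 1 2 ∨ triangle i j k = triangle 0 2 1 := by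
    decide
  have hinj : Function.Injective c := fun i j hij ↦ by
    by_contra h
    exact (hadj h).ne hij
  refine ⟨Hom.toCopy ⟨c ∘ φ, fun h ↦ hadj (φ.injective.ne h)⟩ (hinj.comp φ.injective),
    fun f ↦ {w | f.map φ = triangle 0 1 2 ∧ w ∈ S ∨ f.map φ = triangle 0 2 1 ∧ w ∈ S'},
    fun f g hfg ↦ Set.disjoint_left.2 fun w hf hg ↦ ?_, fun u f ↦ ?_, fun {i j k} h ↦ ?_⟩
  · have hfg' := (cycleMap_injective φ.injective).ne hfg
    obtain ⟨hf, hw⟩ | ⟨hf, hw⟩ := hf <;> obtain ⟨hg, hw'⟩ | ⟨hg, hw'⟩ := hg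
    · exact hfg' (hf.trans hg.symm)
    · exact Set.disjoint_left.1 hSS' hw hw'
    · exact Set.disjoint_left.1 hSS' hw' hw
    · exact hfg' (hf.trans hg.symm)
  · rintro (⟨-, hw⟩ | ⟨-, hw⟩)
    exacts [(hc _).1 hw, (hc _).2 hw]
  · obtain hijk | hijk := horient (φ i) (φ j) (φ k) (φ.injective.ne (T.adj h).ne)
      (φ.injective.ne (T.adj (T.rotate h)).ne) (φ.injective.ne (T.adj (T.rotate (T.rotate h))).ne)
    · simp only [map_triangle, hijk, hne, true_and, false_and, or_false, Set.ofPred_mem_eq]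
      exact of_triangle_eq (p := fun i j k ↦ P (c i) (c j) (c k) S) hP.rotate hijk.symm hS
    · simp only [map_triangle, hijk, hne.symm, true_and, false_and, false_or, Set.ofPred_mem_eq]
      exact of_triangle_eq (p := fun i j k ↦ P (c i) (c j) (c k) S') hP.rotate hijk.symm hS'

theorem exists_pairwise_disjoint_subdivision {ι κ τ : Type*} {r : κ → Set α}
    (hr : Pairwise (Disjoint on r)) {k₀ : κ} {S : ι → Set α} (hS : Pairwise (Disjoint on S))
    (hSr : ∀ i, S i ⊆ r k₀) {p : ι → τ} (hp : p.Injective) {q : κ → τ} (hq : q.Injective)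
    (hpq : ∀ i k, p i ≠ q k) :
    ∃ r' : τ → Set α, Pairwise (Disjoint on r') ∧ (∀ i, r' (p i) = S i) ∧
      (∀ k ≠ k₀, r' (q k) = r k) ∧
      ∀ j, ∀ w ∈ r' j, (∃ i, w ∈ S i) ∨ ∃ k ≠ k₀, w ∈ r k := by
  refine ⟨fun j ↦ {w | (∃ i, j = p i ∧ w ∈ S i) ∨ ∃ k ≠ k₀, j = q k ∧ w ∈ r k},
    fun j j' hjj' ↦ Set.disjoint_left.2 ?_, fun i ↦ ?_, fun k hk ↦ ?_, fun j w hw ↦ ?_⟩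
  · have hdisj {k : κ} {i : ι} {w : α} (hk : k ≠ k₀) (hw : w ∈ S i) (hw' : w ∈ r k) : False :=
      Set.disjoint_left.1 (hr hk) hw' (hSr i hw)
    rintro w (⟨i, rfl, hw⟩ | ⟨k, hk, rfl, hw⟩) (⟨i', rfl, hw'⟩ | ⟨k', hk', rfl, hw'⟩)
    · exact Set.disjoint_left.1 (hS fun hii' ↦ hjj' (congrArg p hii')) hw hw'
    · exact hdisj hk' hw hw'
    · exact hdisj hk hw' hw
    · exact Set.disjoint_left.1 (hr fun hkk' ↦ hjj' (congrArg q hkk')) hw hw'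
  · simp [hp.eq_iff, hpq]
  · simp [hq.eq_iff, (hpq _ _).symm, hk]
  · obtain ⟨i, -, hw⟩ | ⟨k, hk, -, hw⟩ := hw
    exacts [.inl ⟨i, hw⟩, .inr ⟨k, hk, hw⟩]

theorem nonempty_stacking_of_delete (hP : IsStackingSystem H P) {T : OrientedTriangulation G}
    {v : V} {x : Fin 3 → V} (hx : T.IsLink v x) (s : Stacking hx.delete H P) :
    Nonempty (Stacking T H P) := by
  let y (i : Fin 3) : ({v}ᶜ : Set V) := ⟨x i, (hx.adj i).ne'⟩
  let f₀ := triangle (y 0) (y 1) (y 2)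
  obtain ⟨n, hn, hadj, S, hS, hSP⟩ :=
    hP.splits (c := fun i ↦ s.vertex (y i)) (s.isRegion (.inr ⟨0, rfl, rfl, rfl⟩))
  have hS₀ (i : Fin 3) : S i ⊆ s.region f₀ := (hSP i).1.trans Set.sdiff_subset
  obtain ⟨g, hgv, hg⟩ := exists_copy_extend s.vertex (n := n)
    (fun u hu ↦ s.notMem_region u f₀ (hu ▸ hn))
    (fun u hu ↦ by
      obtain ⟨i, hi⟩ := (hx.adj_iff u).1 hu
      exact (Subtype.ext hi : u = y i) ▸ hadj i)
  obtain ⟨r, hr, hrS, hrs, hrw⟩ := exists_pairwise_disjoint_subdivision s.disjoint hS hS₀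
    hx.triangle_injective (cycleMap_injective Subtype.val_injective) fun _ ↦ triangle_ne_map _ _
  refine ⟨g, r, hr, fun u f hu ↦ ?_, fun {a b c} h ↦ ?_⟩
  · obtain rfl | huv := eq_or_ne u v
    · rw [hgv] at hu
      obtain ⟨i, hi⟩ | ⟨f', hf', hf⟩ := hrw f n hu
      · exact ((hSP i).1 hi).2 rfl
      · exact Set.disjoint_left.1 (s.disjoint hf') hf hn
    · rw [hg ⟨u, huv⟩] at hu
      obtain ⟨i, hi⟩ | ⟨f', -, hf⟩ := hrw f _ hu
      exacts [s.notMem_region _ _ (hS₀ i hi), s.notMem_region _ _ hf]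
  · obtain ⟨i, hi⟩ | ⟨a, b, c, rfl, rfl, rfl⟩ := hx.isFace_cases h
    · refine of_triangle_eq (p := fun a b c ↦ P (g a) (g b) (g c) (r (triangle a b c)))
        (fun {a b c} h ↦ (triangle_rotate a b c).symm ▸ hP.rotate h) hi.symm ?_
      rw [hrS, hgv, hg (y (i + 1)), hg (y (i + 2))]
      exact (hSP i).2
    · have hne : triangle a b c ≠ f₀ := fun hf ↦ hx.not_isFace (y 2).2 0 <|
        of_triangle_eq (p := fun a b c : ({v}ᶜ : Set V) ↦ T.IsFace a b c) T.rotate hf h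
      rw [hg, hg, hg, ← map_triangle, hrs _ hne]
      exact s.isRegion (.inl h)

end Stacking

section Embedding

variable {α : Type*} {V : Type u} {G : SimpleGraph V} {H : SimpleGraph α}
  {P : α → α → α → Set α → Prop}

theorem nonempty_stacking (hP : IsStackingSystem H P) (hG : G.IsPlanarThreeTree)
    (T : OrientedTriangulation G) : Nonempty (Stacking T H P) := by
  induction hG with
  | @triangle V _ hcard htop =>
    have : Finite V := Nat.finite_of_card_ne_zero (by lia)
    subst htop
    exact nonempty_stacking_top hP (Finite.equivFinOfCardEq hcard) T
  | step _ hcard htri v hdelete ih =>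
    obtain ⟨x, hx⟩ := T.exists_isLink
      (ncard_neighborSet_of_isPlanarThreeTree (.step _ hcard htri v hdelete) hdelete)
    obtain ⟨s⟩ := ih hx.delete
    exact nonempty_stacking_of_delete hP hx s

theorem nonempty_orientedTriangulation_of_isPlanarThreeTree (hG : G.IsPlanarThreeTree) :
    Nonempty (OrientedTriangulation G) := by
  cases hG with
  | triangle _ hcard htop =>
    have : Finite V := Nat.finite_of_card_ne_zero (by lia)
    subst htop
    exact ⟨.ofEquivFinThree (Finite.equivFinOfCardEq hcard)⟩
  | step _ _ htri =>
    obtain ⟨-, R, -, hR⟩ := htri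
    exact ⟨.ofRotationSystem R hR⟩

theorem isContained_of_isPlanarThreeTree (hP : IsStackingSystem H P)
    (hG : G.IsPlanarThreeTree) : G ⊑ H := by
  obtain ⟨T⟩ := nonempty_orientedTriangulation_of_isPlanarThreeTree hG
  obtain ⟨s⟩ := nonempty_stacking hP hG T
  exact ⟨s.vertex⟩

end Embedding

/-- A triangle of a component: its corners are `(level + i, corner i)` for `i = 0, 1, 2`, and the
component that is stacked into it is placed at `(level, pos)`. -/
structure Face where
  level : ℕ
  pos : ℚ
  corner : Fin 3 → ℚ

/-- Two faces on the same level that are not equal come in the same strict order as their positions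
and the same weak order as each of their corners. -/
def Face.Aligned (f f' : Face) : Prop :=
  f.level = f'.level → f = f' ∨ (f.pos < f'.pos ∧ ∀ i, f.corner i ≤ f'.corner i) ∨
    (f'.pos < f.pos ∧ ∀ i, f'.corner i ≤ f.corner i)

theorem Face.Aligned.symm {f f' : Face} (h : f.Aligned f') : f'.Aligned f := fun hl ↦
  (h hl.symm).imp Eq.symm Or.symm

/-- An edge of a component with a free side. The lower end is `(level, lo)`; the upper end is at
`hi`, one level higher, or two levels if `long`. Whatever is stacked onto the free side gets a
position strictly between `near` and `far`, where `near` is the bound closer to `hi`. -/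
structure EdgeSlot where
  level : ℕ
  lo : ℚ
  hi : ℚ
  long : Bool
  near : ℚ
  far : ℚ
  wf : hi ≤ near ∧ near < far ∨ far < near ∧ near ≤ hi

namespace EdgeSlot

/-- The position of the vertex that is stacked onto an edge. -/
def apex (e : EdgeSlot) : ℚ := (e.near + e.far) / 2

/-- The number of levels between the ends of an edge. -/
def span (e : EdgeSlot) : ℕ := if e.long then 2 else 1

/-- The triangle formed by an edge and the vertex stacked onto it. The apex is one level above the
lower end of a long edge, and two levels above that of a short one. -/
def face (e : EdgeSlot) : Face where
  level := e.level
  pos := e.apex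
  corner := if e.long then ![e.lo, e.apex, e.hi] else ![e.lo, e.hi, e.apex]

/-- The edge from the lower end to the apex, free on the side that faces away from `e`. -/
def lower (e : EdgeSlot) : EdgeSlot where
  level := e.level
  lo := e.lo
  hi := e.apex
  long := !e.long
  near := e.apex
  far := e.far
  wf := by grind [e.wf, apex]

/-- The edge between the upper end and the apex, free on the side that faces away from `e`. -/
def upper (e : EdgeSlot) : EdgeSlot where
  level := e.level + 1
  lo := if e.long then e.apex else e.hi
  hi := if e.long then e.hi else e.apex
  long := false
  near := if e.long then e.near else e.apex
  far := if e.long then e.apex else e.near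
  wf := by grind [e.wf, apex]

/-- The free positions of an edge slot. -/
def range (e : EdgeSlot) : Set ℚ := Set.uIoo e.near e.far

/-- The faces that arise by repeatedly stacking vertices onto the edges of an edge slot. -/
inductive FaceIn : EdgeSlot → Face → Prop
  | here (e : EdgeSlot) : FaceIn e e.face
  | ofLower {e : EdgeSlot} {f : Face} (h : FaceIn e.lower f) : FaceIn e f
  | ofUpper {e : EdgeSlot} {f : Face} (h : FaceIn e.upper f) : FaceIn e f

/-- `(s, x)` is an end of the edge or may be the place of a vertex that is stacked onto it. -/
def Occupies (e : EdgeSlot) (s : ℕ) (x : ℚ) : Prop :=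
  s = e.level ∧ x = e.lo ∨ s = e.level + e.span ∧ x = e.hi ∨ e.level < s ∧ x ∈ e.range

theorem face_corner (e : EdgeSlot) (i : Fin 3) :
    i = 0 ∧ e.face.corner i = e.lo ∨
      i ≠ 0 ∧ (e.face.corner i = e.hi ∨ e.face.corner i = e.apex) := by
  cases hl : e.long <;> fin_cases i <;> simp [face, hl]

theorem mem_range {e : EdgeSlot} {x : ℚ} :
    x ∈ e.range ↔ e.near < x ∧ x < e.far ∨ e.far < x ∧ x < e.near := by
  grind [range, Set.uIoo, e.wf]

theorem mem_range_lower {e : EdgeSlot} {x : ℚ} :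
    x ∈ e.lower.range ↔ e.apex < x ∧ x < e.far ∨ e.far < x ∧ x < e.apex :=
  mem_range

theorem mem_range_upper {e : EdgeSlot} {x : ℚ} :
    x ∈ e.upper.range ↔ e.near < x ∧ x < e.apex ∨ e.apex < x ∧ x < e.near := by
  grind [mem_range, upper]

theorem apex_mem_range (e : EdgeSlot) : e.apex ∈ e.range := by
  grind [mem_range, apex, e.wf]

theorem range_lower_subset (e : EdgeSlot) : e.lower.range ⊆ e.range := fun x hx ↦ by
  grind [mem_range_lower, mem_range, e.apex_mem_range]

theorem range_upper_subset (e : EdgeSlot) : e.upper.range ⊆ e.range := fun x hx ↦ by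
  grind [mem_range_upper, mem_range, e.apex_mem_range]

theorem apex_notMem_range_lower (e : EdgeSlot) : e.apex ∉ e.lower.range := by
  grind [mem_range_lower]

theorem apex_notMem_range_upper (e : EdgeSlot) : e.apex ∉ e.upper.range := by
  grind [mem_range_upper]

theorem disjoint_range_lower_upper (e : EdgeSlot) : Disjoint e.lower.range e.upper.range :=
  Set.disjoint_left.2 fun x hx hx' ↦ by
    grind [mem_range_lower, mem_range_upper, mem_range, e.apex_mem_range]

theorem Occupies.of_lower {e : EdgeSlot} {s : ℕ} {x : ℚ} (h : e.lower.Occupies s x) :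
    e.Occupies s x := by
  grind [Occupies, lower, span, range_lower_subset e, apex_mem_range]

theorem Occupies.of_upper {e : EdgeSlot} {s : ℕ} {x : ℚ} (h : e.upper.Occupies s x) :
    e.Occupies s x := by
  grind [Occupies, upper, span, range_upper_subset e, apex_mem_range]

namespace FaceIn

variable {e : EdgeSlot} {f f' : Face}

theorem level_le (h : e.FaceIn f) : e.level ≤ f.level := by
  induction h with
  | here => exact le_rfl
  | ofLower _ ih => exact ih
  | ofUpper _ ih => exact (Nat.le_succ _).trans ih

theorem pos_mem_range (h : e.FaceIn f) : f.pos ∈ e.range := by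
  induction h with
  | here e => exact e.apex_mem_range
  | ofLower _ ih => exact range_lower_subset _ ih
  | ofUpper _ ih => exact range_upper_subset _ ih

theorem occupies (h : e.FaceIn f) (i : Fin 3) : e.Occupies (f.level + i) (f.corner i) := by
  induction h with
  | here e => cases hl : e.long <;> fin_cases i <;> simp [face, Occupies, span, hl, apex_mem_range]
  | ofLower _ ih => exact ih.of_lower
  | ofUpper _ ih => exact ih.of_upper

theorem aligned_of_lower (h : e.lower.FaceIn f) : e.face.Aligned f := fun hl ↦ by
  have hpos := mem_range_lower.1 h.pos_mem_range
  have hcorner (i : Fin 3) : e.face.corner i = f.corner i ∨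
      (e.face.corner i = e.hi ∨ e.face.corner i = e.apex) ∧
        (f.corner i = e.apex ∨ f.corner i ∈ e.lower.range) := by
    have := h.occupies i
    have : e.face.level = e.level := rfl
    grind [Occupies, lower, span, face_corner, level_le h]
  right
  grind [mem_range_lower, face, e.wf, apex]

theorem aligned_of_upper (h : e.upper.FaceIn f) : e.face.Aligned f := fun hl ↦
  absurd (hl.trans_ge h.level_le) (Nat.not_succ_le_self _)

theorem aligned_of_lower_upper (h : e.lower.FaceIn f) (h' : e.upper.FaceIn f') :
    f.Aligned f' := fun hl ↦ by
  have hpos := mem_range_lower.1 h.pos_mem_range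
  have hpos' := mem_range_upper.1 h'.pos_mem_range
  have hlevel : e.level + 1 ≤ f'.level := h'.level_le
  have hcorner (i : Fin 3) : f.corner i = e.apex ∨ f.corner i ∈ e.lower.range := by
    grind [h.occupies i, Occupies, lower]
  have hcorner' (i : Fin 3) :
      f'.corner i = e.hi ∨ f'.corner i = e.apex ∨ f'.corner i ∈ e.upper.range := by
    grind [h'.occupies i, Occupies, upper]
  right
  grind [mem_range_lower, mem_range_upper, e.wf, apex]

theorem aligned (h : e.FaceIn f) (h' : e.FaceIn f') : f.Aligned f' := by
  induction h generalizing f' with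
  | here e =>
    cases h' with
    | here => exact fun _ ↦ Or.inl rfl
    | ofLower h' => exact aligned_of_lower h'
    | ofUpper h' => exact aligned_of_upper h'
  | ofLower h ih =>
    cases h' with
    | here => exact (aligned_of_lower h).symm
    | ofLower h' => exact ih h'
    | ofUpper h' => exact aligned_of_lower_upper h h'
  | ofUpper h ih =>
    cases h' with
    | here => exact (aligned_of_upper h).symm
    | ofLower h' => exact (aligned_of_lower_upper h' h).symm
    | ofUpper h' => exact ih h'

end FaceIn

end EdgeSlot

/-- A vertex `(level, base)` of a component with a free sector above it: whatever is stacked there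
gets a position strictly between `left` and `right`. -/
structure VertexSlot where
  level : ℕ
  base : ℚ
  left : ℚ
  right : ℚ
  lt : left < right

namespace VertexSlot

/-- The position of the neighbour of the base that is stacked into a vertex slot. -/
def apex (v : VertexSlot) : ℚ := (v.left + v.right) / 2

/-- The right bound of the positions above the apex. -/
def upRight (v : VertexSlot) : ℚ := (v.apex + v.right) / 2

theorem apex_mem_Ioo (v : VertexSlot) : v.apex ∈ Set.Ioo v.left v.right := by
  grind [apex, v.lt]

theorem upRight_mem_Ioo (v : VertexSlot) : v.upRight ∈ Set.Ioo v.apex v.right := by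
  grind [upRight, v.apex_mem_Ioo]

/-- The edge from the base to the apex, free on its left side. -/
def leftSide (v : VertexSlot) : EdgeSlot where
  level := v.level
  lo := v.base
  hi := v.apex
  long := false
  near := v.apex
  far := v.left
  wf := by grind [v.apex_mem_Ioo]

/-- The edge from the base to the apex, free on its right side. -/
def rightSide (v : VertexSlot) : EdgeSlot where
  level := v.level
  lo := v.base
  hi := v.apex
  long := false
  near := v.upRight
  far := v.right
  wf := by grind [v.upRight_mem_Ioo]

/-- The vertex slot above the apex. -/
def up (v : VertexSlot) : VertexSlot where
  level := v.level + 1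
  base := v.apex
  left := v.apex
  right := v.upRight
  lt := v.upRight_mem_Ioo.1

/-- The free positions of a vertex slot. -/
def range (v : VertexSlot) : Set ℚ := Set.Ioo v.left v.right

/-- The faces that arise by repeatedly stacking vertices into a vertex slot. -/
inductive FaceIn : VertexSlot → Face → Prop
  | ofLeft {v : VertexSlot} {f : Face} (h : v.leftSide.FaceIn f) : FaceIn v f
  | ofRight {v : VertexSlot} {f : Face} (h : v.rightSide.FaceIn f) : FaceIn v f
  | ofUp {v : VertexSlot} {f : Face} (h : FaceIn v.up f) : FaceIn v f

/-- `(s, x)` is the base or may be the place of a vertex that is stacked into the slot. -/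
def Occupies (v : VertexSlot) (s : ℕ) (x : ℚ) : Prop :=
  s = v.level ∧ x = v.base ∨ v.level < s ∧ x ∈ v.range

theorem mem_range {v : VertexSlot} {x : ℚ} : x ∈ v.range ↔ v.left < x ∧ x < v.right := Iff.rfl

theorem mem_range_leftSide {v : VertexSlot} {x : ℚ} :
    x ∈ v.leftSide.range ↔ v.left < x ∧ x < v.apex := by
  grind [EdgeSlot.mem_range, leftSide, v.apex_mem_Ioo]

theorem mem_range_rightSide {v : VertexSlot} {x : ℚ} :
    x ∈ v.rightSide.range ↔ v.upRight < x ∧ x < v.right := by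
  grind [EdgeSlot.mem_range, rightSide, v.upRight_mem_Ioo]

theorem mem_range_up {v : VertexSlot} {x : ℚ} : x ∈ v.up.range ↔ v.apex < x ∧ x < v.upRight :=
  Iff.rfl

theorem range_leftSide_subset (v : VertexSlot) : v.leftSide.range ⊆ v.range := fun x hx ↦ by
  grind [mem_range_leftSide, mem_range, v.apex_mem_Ioo]

theorem range_rightSide_subset (v : VertexSlot) : v.rightSide.range ⊆ v.range := fun x hx ↦ by
  grind [mem_range_rightSide, mem_range, v.apex_mem_Ioo, v.upRight_mem_Ioo]

theorem range_up_subset (v : VertexSlot) : v.up.range ⊆ v.range := fun x hx ↦ by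
  grind [mem_range_up, mem_range, v.apex_mem_Ioo, v.upRight_mem_Ioo]

theorem apex_notMem_range_leftSide (v : VertexSlot) : v.apex ∉ v.leftSide.range := by
  grind [mem_range_leftSide]

theorem apex_notMem_range_rightSide (v : VertexSlot) : v.apex ∉ v.rightSide.range := by
  grind [mem_range_rightSide, v.upRight_mem_Ioo]

theorem apex_notMem_range_up (v : VertexSlot) : v.apex ∉ v.up.range := by
  grind [mem_range_up]

theorem disjoint_range_leftSide_rightSide (v : VertexSlot) :
    Disjoint v.leftSide.range v.rightSide.range :=
  Set.disjoint_left.2 fun x hx hx' ↦ by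
    grind [mem_range_leftSide, mem_range_rightSide, v.upRight_mem_Ioo]

theorem disjoint_range_leftSide_up (v : VertexSlot) : Disjoint v.leftSide.range v.up.range :=
  Set.disjoint_left.2 fun x hx hx' ↦ by grind [mem_range_leftSide, mem_range_up]

theorem disjoint_range_up_rightSide (v : VertexSlot) : Disjoint v.up.range v.rightSide.range :=
  Set.disjoint_left.2 fun x hx hx' ↦ by grind [mem_range_up, mem_range_rightSide]

namespace FaceIn

variable {v : VertexSlot} {f f' : Face}

theorem level_le (h : v.FaceIn f) : v.level ≤ f.level := by
  induction h with
  | ofLeft h | ofRight h => exact h.level_le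
  | ofUp _ ih => exact (Nat.le_succ _).trans ih

theorem pos_mem_range (h : v.FaceIn f) : f.pos ∈ v.range := by
  induction h with
  | ofLeft h => exact range_leftSide_subset _ h.pos_mem_range
  | ofRight h => exact range_rightSide_subset _ h.pos_mem_range
  | ofUp _ ih => exact range_up_subset _ ih

theorem occupies (h : v.FaceIn f) (i : Fin 3) : v.Occupies (f.level + i) (f.corner i) := by
  induction h with
  | @ofLeft v _ h =>
    grind [h.occupies i, EdgeSlot.Occupies, Occupies, leftSide, EdgeSlot.span,
      v.range_leftSide_subset, v.apex_mem_Ioo, range]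
  | @ofRight v _ h =>
    grind [h.occupies i, EdgeSlot.Occupies, Occupies, rightSide, EdgeSlot.span,
      v.range_rightSide_subset, v.apex_mem_Ioo, range]
  | @ofUp v _ _ ih =>
    grind [Occupies, up, v.range_up_subset, v.apex_mem_Ioo, range]

theorem aligned_of_left_right (h : v.leftSide.FaceIn f) (h' : v.rightSide.FaceIn f') :
    f.Aligned f' := fun hl ↦ by
  have hcorner (i : Fin 3) : f.corner i ≤ f'.corner i := by
    grind [h.occupies i, h'.occupies i, EdgeSlot.Occupies, leftSide, rightSide, EdgeSlot.span,
      mem_range_leftSide, mem_range_rightSide, v.upRight_mem_Ioo]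
  refine Or.inr (Or.inl ⟨?_, hcorner⟩)
  grind [mem_range_leftSide.1 h.pos_mem_range, mem_range_rightSide.1 h'.pos_mem_range,
    v.upRight_mem_Ioo]

theorem aligned_of_left_up (h : v.leftSide.FaceIn f) (h' : v.up.FaceIn f') :
    f.Aligned f' := fun hl ↦ by
  have hcorner (i : Fin 3) : f.corner i ≤ f'.corner i := by
    have : v.level + 1 ≤ f'.level := h'.level_le
    grind [h.occupies i, h'.occupies i, EdgeSlot.Occupies, Occupies, leftSide, up, EdgeSlot.span,
      mem_range_leftSide, mem_range_up]
  refine Or.inr (Or.inl ⟨?_, hcorner⟩)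
  grind [mem_range_leftSide.1 h.pos_mem_range, mem_range_up.1 h'.pos_mem_range]

theorem aligned_of_up_right (h : v.up.FaceIn f) (h' : v.rightSide.FaceIn f') :
    f.Aligned f' := fun hl ↦ by
  have hcorner (i : Fin 3) : f.corner i ≤ f'.corner i := by
    have : v.level + 1 ≤ f.level := h.level_le
    grind [h.occupies i, h'.occupies i, EdgeSlot.Occupies, Occupies, rightSide, up, EdgeSlot.span,
      mem_range_up, mem_range_rightSide, v.upRight_mem_Ioo]
  refine Or.inr (Or.inl ⟨?_, hcorner⟩)
  grind [mem_range_up.1 h.pos_mem_range, mem_range_rightSide.1 h'.pos_mem_range]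

theorem aligned (h : v.FaceIn f) (h' : v.FaceIn f') : f.Aligned f' := by
  induction h generalizing f' with
  | ofLeft h =>
    cases h' with
    | ofLeft h' => exact h.aligned h'
    | ofRight h' => exact aligned_of_left_right h h'
    | ofUp h' => exact aligned_of_left_up h h'
  | ofRight h =>
    cases h' with
    | ofLeft h' => exact (aligned_of_left_right h' h).symm
    | ofRight h' => exact h.aligned h'
    | ofUp h' => exact (aligned_of_up_right h' h).symm
  | ofUp h ih =>
    cases h' with
    | ofLeft h' => exact (aligned_of_left_up h' h).symm
    | ofRight h' => exact aligned_of_up_right h h'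
    | ofUp h' => exact ih h'

end FaceIn

end VertexSlot

/-- The three slots at the lowest vertex `(0, 0)` of a component. -/
def root (j : Fin 3) : VertexSlot where
  level := 0
  base := 0
  left := (j : ℕ)
  right := (j : ℕ) + 1
  lt := by simp

/-- A face of the component, which is stacked into three vertex slots at a common base. -/
def IsComponentFace (f : Face) : Prop := ∃ j, (root j).FaceIn f

theorem lt_of_mem_range_root {i j : Fin 3} (h : i < j) {x y : ℚ} (hx : x ∈ (root i).range)
    (hy : y ∈ (root j).range) : x < y := by
  have hij : (((i : ℕ) + 1 : ℕ) : ℚ) ≤ (j : ℕ) := Nat.cast_le.2 h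
  push_cast at hij
  exact hx.2.trans_le (hij.trans hy.1.le)

theorem aligned_of_root_lt {i j : Fin 3} (h : i < j) {f f' : Face} (hf : (root i).FaceIn f)
    (hf' : (root j).FaceIn f') : f.Aligned f' := fun hl ↦ by
  have hcorner (k : Fin 3) : f.corner k ≤ f'.corner k := by
    have hlt := lt_of_mem_range_root h (x := f.corner k) (y := f'.corner k)
    grind [hf.occupies k, hf'.occupies k, VertexSlot.Occupies, root]
  exact Or.inr (Or.inl ⟨lt_of_mem_range_root h hf.pos_mem_range hf'.pos_mem_range, hcorner⟩)

theorem IsComponentFace.aligned {f f' : Face} (h : IsComponentFace f) (h' : IsComponentFace f') :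
    f.Aligned f' := by
  obtain ⟨i, h⟩ := h
  obtain ⟨j, h'⟩ := h'
  obtain hij | rfl | hij := lt_trichotomy i j
  · exact aligned_of_root_lt hij h h'
  · exact h.aligned h'
  · exact (aligned_of_root_lt hij h' h).symm

/-- A vertex of a component, or the position of a component in a face. -/
abbrev Place : Type := ℕ ×ₗ ℚ

namespace Face

/-- The place of the component that is stacked into a face. -/
def place (f : Face) : Place := toLex (f.level, f.pos)

/-- The corners of a face. -/
def vertex (f : Face) (i : Fin 3) : Place := toLex (f.level + i, f.corner i)

theorem Aligned.place_lt_place {f f' : Face} (h : f.Aligned f') {i : Fin 3}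
    (hi : f.vertex i < f'.vertex i) : f.place < f'.place := by
  simp only [vertex, place, Prod.Lex.toLex_lt_toLex] at *
  grind [Aligned]

end Face

/-- A vertex is encoded by the places of the faces that surround its component, from the outermost
to the innermost one, followed by its own place in the component. -/
abbrev Code : Type := List Place

/-- The order key of codes: they are compared by length first, and then lexicographically. -/
def rank (l : Code) : ℕ ×ₗ Code := toLex (l.length, l)

theorem rank_injective : Function.Injective rank := fun _ _ h ↦ (Prod.ext_iff.1 h).2

theorem rank_lt_rank {l l' : Code} :
    rank l < rank l' ↔ l.length < l'.length ∨ l.length = l'.length ∧ l < l' :=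
  Prod.Lex.toLex_lt_toLex

theorem append_singleton_lt_append_singleton {α : Type*} [LinearOrder α] {l l' : List α} {p p' : α}
    (h : l.length = l'.length) : l ++ [p] < l' ++ [p'] ↔ l < l' ∨ l = l' ∧ p < p' := by
  induction l generalizing l' with
  | nil =>
    obtain rfl : l' = [] := List.length_eq_zero_iff.1 h.symm
    simp [List.cons_lt_cons_iff]
  | cons a l ih =>
    obtain _ | ⟨a', l'⟩ := l'
    · simp at h
    · rw [List.length_cons, List.length_cons, Nat.add_right_cancel_iff] at h
      simp only [List.cons_append, List.cons_lt_cons_iff, ih h, List.cons.injEq]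
      tauto

theorem rank_append_singleton_lt {l l' : Code} {p p' : Place} :
    rank (l ++ [p]) < rank (l' ++ [p']) ↔ rank l < rank l' ∨ l = l' ∧ p < p' := by
  simp only [rank_lt_rank, List.length_append, List.length_singleton, Nat.add_lt_add_iff_right,
    Nat.add_right_cancel_iff]
  grind [append_singleton_lt_append_singleton]

/-- `k` is the code of a face of some component, and its corners have the codes `c`. -/
def IsFaceCode (k : Code) (c : Fin 3 → Code) : Prop :=
  ∃ (g : Code) (f : Face), IsComponentFace f ∧ k = g ++ [f.place] ∧ c = fun i ↦ g ++ [f.vertex i]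

namespace IsFaceCode

variable {k k' : Code} {c c' : Fin 3 → Code}

theorem rank_lt (h : IsFaceCode k c) (h' : IsFaceCode k' c') {i : Fin 3}
    (hi : rank (c i) < rank (c' i)) : rank k < rank k' := by
  obtain ⟨g, f, hf, rfl, rfl⟩ := h
  obtain ⟨g', f', hf', rfl, rfl⟩ := h'
  rw [rank_append_singleton_lt] at hi ⊢
  exact hi.imp_right (And.imp_right (hf.aligned hf').place_lt_place)

theorem length_eq (h : IsFaceCode k c) (i : Fin 3) : (c i).length = k.length := by
  obtain ⟨g, f, -, rfl, rfl⟩ := h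
  simp

end IsFaceCode

/-- The edges of the five queues, directed from the lower to the higher rank. Two queues hold the
edges from the lowest corner of a face to the two other ones, the remaining three hold the edges
between a corner of a face and the vertices of the component inside the face. -/
inductive InQueue : Fin 2 ⊕ Fin 3 → Code → Code → Prop
  | level {k : Code} {c : Fin 3 → Code} (h : IsFaceCode k c) (j : Fin 2) :
      InQueue (Sum.inl j) (c 0) (c j.succ)
  | binding {k : Code} {c : Fin 3 → Code} (h : IsFaceCode k c) (i : Fin 3) (p : Place) :
      InQueue (Sum.inr i) (c i) (k ++ [p])

namespace InQueue

variable {q : Fin 2 ⊕ Fin 3} {a b c d : Code}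

theorem rank_lt (h : InQueue q a b) : rank a < rank b := by
  cases h with
  | level h j =>
    obtain ⟨g, f, -, -, rfl⟩ := h
    rw [rank_append_singleton_lt]
    exact Or.inr ⟨rfl, Prod.Lex.toLex_lt_toLex.2 (Or.inl (by simp))⟩
  | binding h i p =>
    rw [rank_lt_rank, h.length_eq]
    simp

theorem not_nested (h : InQueue q a b) (h' : InQueue q c d) (hac : rank a < rank c) :
    ¬ rank d < rank b := by
  cases h with
  | level h j =>
    cases h' with
    | level h' => exact fun hdb ↦ lt_asymm (h.rank_lt h' hac) (h'.rank_lt h hdb)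
  | binding h i p =>
    cases h' with
    | binding h' => exact lt_asymm (rank_append_singleton_lt.2 (Or.inl (h.rank_lt h' hac)))

end InQueue

/-- The graph formed by the edges of the five queues. Every planar 3-tree is contained in it. -/
def codeGraph : SimpleGraph Code := SimpleGraph.fromRel fun a b ↦ ∃ q, InQueue q a b

theorem InQueue.adj {q : Fin 2 ⊕ Fin 3} {a b : Code} (h : InQueue q a b) : codeGraph.Adj a b :=
  (SimpleGraph.fromRel_adj _ a b).2 ⟨fun hab ↦ h.rank_lt.ne (congrArg rank hab), Or.inl ⟨q, h⟩⟩

theorem nonempty_queueLayout_codeGraph : Nonempty (codeGraph.QueueLayout 5) := by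
  refine nonempty_queueLayout rank rank_injective InQueue InQueue.rank_lt InQueue.not_nested
    fun hab ↦ ?_
  obtain ⟨-, ⟨q, h⟩ | ⟨q, h⟩⟩ := (SimpleGraph.fromRel_adj _ _ _).1 hab
  · exact ⟨q, Or.inl h⟩
  · exact ⟨q, Or.inr h⟩

theorem IsFaceCode.adj {k : Code} {c : Fin 3 → Code} (h : IsFaceCode k c) (p : Place) (i : Fin 3) :
    codeGraph.Adj (k ++ [p]) (c i) :=
  (InQueue.binding h i p).adj.symm

/-- The codes that extend `k` by a place with position in `I`. -/
def inside (k : Code) (I : Set ℚ) : Set Code := {l | ∃ p r, l = k ++ p :: r ∧ (ofLex p).2 ∈ I}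

section inside

variable {k l : Code} {I J : Set ℚ} {p : Place}

theorem append_cons_mem_inside {r : Code} : k ++ p :: r ∈ inside k I ↔ (ofLex p).2 ∈ I := by
  simp only [inside, Set.mem_ofPred_eq, List.append_cancel_left_eq, List.cons.injEq]
  grind

theorem length_lt_of_mem_inside (h : l ∈ inside k I) : k.length < l.length := by
  obtain ⟨p, r, rfl, -⟩ := h
  simp

theorem inside_mono (h : I ⊆ J) : inside k I ⊆ inside k J := by
  rintro _ ⟨p, r, rfl, hp⟩
  exact ⟨p, r, rfl, h hp⟩

theorem inside_append_singleton_subset (h : (ofLex p).2 ∈ J) :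
    inside (k ++ [p]) I ⊆ inside k J := by
  rintro _ ⟨q, r, rfl, -⟩
  exact ⟨p, q :: r, by simp, h⟩

theorem disjoint_inside (h : Disjoint I J) : Disjoint (inside k I) (inside k J) := by
  rw [Set.disjoint_left]
  rintro _ ⟨p, r, rfl, hp⟩ hJ
  exact Set.disjoint_left.1 h hp (append_cons_mem_inside.1 hJ)

theorem disjoint_inside_append_singleton (h : (ofLex p).2 ∉ J) :
    Disjoint (inside (k ++ [p]) I) (inside k J) :=
  (disjoint_inside (Set.disjoint_singleton_left.2 h)).mono_left
    (inside_append_singleton_subset (Set.mem_singleton _))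

theorem append_singleton_notMem_inside {q : Place} : k ++ [q] ∉ inside (k ++ [p]) I := fun h ↦ by
  simpa using length_lt_of_mem_inside h

end inside

namespace EdgeSlot

/-- The lower end of the edge. -/
def bottom (e : EdgeSlot) : Place := toLex (e.level, e.lo)

/-- The upper end of the edge. -/
def top (e : EdgeSlot) : Place := toLex (e.level + e.span, e.hi)

theorem vertex_face_zero (e : EdgeSlot) : e.face.vertex 0 = e.bottom := by
  cases hl : e.long <;> simp [Face.vertex, face, hl, bottom]

theorem vertex_face_succ (e : EdgeSlot) :
    e.face.vertex 1 = e.lower.top ∧ e.face.vertex 2 = e.top ∨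
      e.face.vertex 1 = e.top ∧ e.face.vertex 2 = e.lower.top := by
  cases hl : e.long <;> simp [Face.vertex, face, hl, top, lower, span]

theorem ends_upper (e : EdgeSlot) :
    e.upper.bottom = e.lower.top ∧ e.upper.top = e.top ∨
      e.upper.bottom = e.top ∧ e.upper.top = e.lower.top := by
  cases hl : e.long <;> simp [bottom, top, lower, upper, span, hl]

/-- All faces of the slot are faces of the component. -/
def IsInComponent (e : EdgeSlot) : Prop := ∀ f, e.FaceIn f → IsComponentFace f

namespace IsInComponent

variable {e : EdgeSlot}

theorem lower (h : e.IsInComponent) : e.lower.IsInComponent := fun f hf ↦ h f (.ofLower hf)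

theorem upper (h : e.IsInComponent) : e.upper.IsInComponent := fun f hf ↦ h f (.ofUpper hf)

theorem isFaceCode (h : e.IsInComponent) (k : Code) :
    IsFaceCode (k ++ [e.face.place]) fun i ↦ k ++ [e.face.vertex i] :=
  ⟨k, e.face, h _ (.here e), rfl, rfl⟩

theorem adj (h : e.IsInComponent) (k : Code) : codeGraph.Adj (k ++ [e.bottom]) (k ++ [e.top]) := by
  have hadj (j : Fin 2) := (InQueue.level (h.isFaceCode k) j).adj
  have h0 := hadj 0
  have h1 := hadj 1
  simp only [vertex_face_zero, Fin.succ_zero_eq_one, Fin.succ_one_eq_two] at h0 h1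
  obtain ⟨-, h2⟩ | ⟨h2, -⟩ := e.vertex_face_succ
  · rwa [h2] at h1
  · rwa [h2] at h0

theorem adj_upper (h : e.IsInComponent) (k : Code) :
    codeGraph.Adj (k ++ [e.lower.top]) (k ++ [e.top]) := by
  have hadj := h.upper.adj k
  obtain ⟨h1, h2⟩ | ⟨h1, h2⟩ := e.ends_upper <;> rw [h1, h2] at hadj
  exacts [hadj, hadj.symm]

end IsInComponent

end EdgeSlot

namespace VertexSlot

/-- The vertex of the slot. -/
def bottom (v : VertexSlot) : Place := toLex (v.level, v.base)

/-- All faces of the slot are faces of the component. -/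
def IsInComponent (v : VertexSlot) : Prop := ∀ f, v.FaceIn f → IsComponentFace f

namespace IsInComponent

variable {v : VertexSlot}

theorem leftSide (h : v.IsInComponent) : v.leftSide.IsInComponent := fun f hf ↦ h f (.ofLeft hf)

theorem rightSide (h : v.IsInComponent) : v.rightSide.IsInComponent := fun f hf ↦ h f (.ofRight hf)

theorem up (h : v.IsInComponent) : v.up.IsInComponent := fun f hf ↦ h f (.ofUp hf)

end IsInComponent

theorem isInComponent_root (j : Fin 3) : (root j).IsInComponent := fun _ hf ↦ ⟨j, hf⟩

end VertexSlot

/-- `IsRegion a b c S` says that the vertices inside the triangle `a b c` can be given codes in `S`: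
the triangle is a face, it consists of a corner of the surrounding face and an edge with a free
side, or it consists of two corners of the surrounding face and a vertex with a free sector. -/
inductive IsRegion : Code → Code → Code → Set Code → Prop
  | face {k : Code} {c : Fin 3 → Code} (h : IsFaceCode k c) :
      IsRegion (c 0) (c 1) (c 2) (inside k Set.univ)
  | edge {k : Code} {c : Fin 3 → Code} (h : IsFaceCode k c) (i : Fin 3) {e : EdgeSlot}
      (he : e.IsInComponent) : IsRegion (c i) (k ++ [e.bottom]) (k ++ [e.top]) (inside k e.range)
  | vertex {k : Code} {c : Fin 3 → Code} (h : IsFaceCode k c) (i j : Fin 3) {v : VertexSlot}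
      (hv : v.IsInComponent) : IsRegion (c i) (c j) (k ++ [v.bottom]) (inside k v.range)
  | rotate {a b c : Code} {S : Set Code} (h : IsRegion a b c S) : IsRegion b c a S
  | reverse {a b c : Code} {S : Set Code} (h : IsRegion a b c S) : IsRegion a c b S

namespace EdgeSlot.IsInComponent

variable {e : EdgeSlot} {k : Code}

theorem isRegion_face (he : e.IsInComponent) (k : Code) :
    IsRegion (k ++ [e.lower.top]) (k ++ [e.bottom]) (k ++ [e.top])
      (inside (k ++ [e.face.place]) Set.univ) := by
  have h := IsRegion.face (he.isFaceCode k)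
  rw [e.vertex_face_zero] at h
  obtain ⟨h1, h2⟩ | ⟨h1, h2⟩ := e.vertex_face_succ <;> rw [h1, h2] at h
  exacts [h.reverse.rotate.rotate, h.rotate.rotate]

theorem isRegion_upper (he : e.IsInComponent) {c : Fin 3 → Code} (h : IsFaceCode k c) (i : Fin 3) :
    IsRegion (k ++ [e.lower.top]) (k ++ [e.top]) (c i) (inside k e.upper.range) := by
  have h := IsRegion.edge h i he.upper
  obtain ⟨h1, h2⟩ | ⟨h1, h2⟩ := e.ends_upper <;> rw [h1, h2] at h
  exacts [h.rotate, h.reverse.rotate]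

end EdgeSlot.IsInComponent

theorem splits_of_isRegion {a b c n : Code} {S S₁ S₂ S₃ : Set Code} (hn : n ∈ S)
    (ha : codeGraph.Adj n a) (hb : codeGraph.Adj n b) (hc : codeGraph.Adj n c)
    (h₁ : IsRegion n b c S₁) (h₂ : IsRegion n c a S₂) (h₃ : IsRegion n a b S₃)
    (hS₁ : S₁ ⊆ S \ {n}) (hS₂ : S₂ ⊆ S \ {n}) (hS₃ : S₃ ⊆ S \ {n})
    (h₁₂ : Disjoint S₁ S₂) (h₁₃ : Disjoint S₁ S₃) (h₂₃ : Disjoint S₂ S₃) :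
    Splits codeGraph IsRegion ![a, b, c] S := by
  refine ⟨n, hn, ?_, ![S₁, S₂, S₃], ?_, ?_⟩
  · simp [Fin.forall_fin_succ, *]
  · simp [Pairwise, Fin.forall_fin_succ, Function.onFun, *, disjoint_comm]
  · simp [Fin.forall_fin_succ, *]

theorem IsFaceCode.splits {k : Code} {c : Fin 3 → Code} (h : IsFaceCode k c) :
    Splits codeGraph IsRegion c (inside k Set.univ) := by
  have hroot (j : Fin 3) : (0 : ℚ) ∉ (root j).range := fun h0 ↦
    (Nat.cast_nonneg (j : ℕ)).not_gt h0.1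
  refine ⟨k ++ [toLex (0, 0)], append_cons_mem_inside.2 trivial, h.adj _,
    fun j ↦ inside k (root j).range, fun i j hij ↦ disjoint_inside ?_, fun j ↦ ⟨?_, ?_⟩⟩
  · rw [Set.disjoint_left]
    intro x hx hx'
    obtain hij | hij := hij.lt_or_gt
    · exact lt_irrefl x (lt_of_mem_range_root hij hx hx')
    · exact lt_irrefl x (lt_of_mem_range_root hij hx' hx)
  · exact Set.subset_sdiff_singleton (inside_mono (Set.subset_univ _))
      fun h0 ↦ hroot j (append_cons_mem_inside.1 h0)
  · exact (IsRegion.vertex h (j + 1) (j + 2) (VertexSlot.isInComponent_root j)).rotate.rotate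

theorem EdgeSlot.IsInComponent.splits {e : EdgeSlot} (he : e.IsInComponent) {k : Code}
    {c : Fin 3 → Code} (h : IsFaceCode k c) (i : Fin 3) :
    Splits codeGraph IsRegion ![c i, k ++ [e.bottom], k ++ [e.top]] (inside k e.range) := by
  have hsub {I : Set ℚ} (hI : I ⊆ e.range) (hapex : e.apex ∉ I) :
      inside k I ⊆ inside k e.range \ {k ++ [e.lower.top]} :=
    Set.subset_sdiff_singleton (inside_mono hI) fun h ↦ hapex (append_cons_mem_inside.1 h)
  exact splits_of_isRegion ((append_cons_mem_inside (p := e.lower.top)).2 e.apex_mem_range)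
    (h.adj _ i) (he.lower.adj k).symm (he.adj_upper k)
    (he.isRegion_face k) (he.isRegion_upper h i) (IsRegion.edge h i he.lower).rotate.rotate
    (Set.subset_sdiff_singleton (inside_append_singleton_subset e.apex_mem_range)
      append_singleton_notMem_inside)
    (hsub e.range_upper_subset e.apex_notMem_range_upper)
    (hsub e.range_lower_subset e.apex_notMem_range_lower)
    (disjoint_inside_append_singleton e.apex_notMem_range_upper)
    (disjoint_inside_append_singleton e.apex_notMem_range_lower)
    (disjoint_inside e.disjoint_range_lower_upper.symm)

theorem VertexSlot.IsInComponent.splits {v : VertexSlot} (hv : v.IsInComponent) {k : Code}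
    {c : Fin 3 → Code} (h : IsFaceCode k c) (i j : Fin 3) :
    Splits codeGraph IsRegion ![c i, c j, k ++ [v.bottom]] (inside k v.range) := by
  have hsub {I : Set ℚ} (hI : I ⊆ v.range) (hapex : v.apex ∉ I) :
      inside k I ⊆ inside k v.range \ {k ++ [v.up.bottom]} :=
    Set.subset_sdiff_singleton (inside_mono hI) fun h ↦ hapex (append_cons_mem_inside.1 h)
  exact splits_of_isRegion ((append_cons_mem_inside (p := v.up.bottom)).2 v.apex_mem_Ioo)
    (h.adj _ i) (h.adj _ j) (hv.leftSide.adj k).symm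
    (IsRegion.edge h j hv.rightSide).rotate.rotate
    (IsRegion.edge h i hv.leftSide).rotate.rotate.reverse
    (IsRegion.vertex h i j hv.up).rotate.rotate
    (hsub v.range_rightSide_subset v.apex_notMem_range_rightSide)
    (hsub v.range_leftSide_subset v.apex_notMem_range_leftSide)
    (hsub v.range_up_subset v.apex_notMem_range_up)
    (disjoint_inside v.disjoint_range_leftSide_rightSide.symm)
    (disjoint_inside v.disjoint_range_up_rightSide.symm)
    (disjoint_inside v.disjoint_range_leftSide_up)

theorem IsRegion.splits {a b c : Code} {S : Set Code} (h : IsRegion a b c S) :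
    Splits codeGraph IsRegion ![a, b, c] S := by
  induction h with
  | face h =>
    convert h.splits using 1
    exact List.ofFn_injective rfl
  | edge h i he => exact he.splits h i
  | vertex h i j hv => exact hv.splits h i j
  | rotate _ ih =>
    obtain ⟨n, hn, hadj, T, hT, hP⟩ := ih
    exact splits_of_isRegion hn (hadj 1) (hadj 2) (hadj 0) (hP 1).2 (hP 2).2 (hP 0).2 (hP 1).1
      (hP 2).1 (hP 0).1 (hT (by decide)) (hT (by decide)) (hT (by decide))
  | reverse _ ih =>
    obtain ⟨n, hn, hadj, T, hT, hP⟩ := ih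
    exact splits_of_isRegion hn (hadj 0) (hadj 2) (hadj 1) (hP 0).2.reverse (hP 2).2.reverse
      (hP 1).2.reverse (hP 0).1 (hP 2).1 (hP 1).1 (hT (by decide)) (hT (by decide))
      (hT (by decide))

theorem isStackingSystem_isRegion : IsStackingSystem codeGraph IsRegion where
  rotate := IsRegion.rotate
  splits h := by
    convert h.splits using 1
    exact List.ofFn_injective rfl
  exists_triangle := by
    let v := root 0
    have hv : v.IsInComponent := VertexSlot.isInComponent_root 0
    let c : Fin 3 → Code := fun i ↦ [] ++ [v.leftSide.face.vertex i]
    let k : Code := [] ++ [v.leftSide.face.place]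
    have h : IsFaceCode k c := hv.leftSide.isFaceCode []
    have hc (I : Set ℚ) : c 0 ∉ inside k I := fun hI ↦
      (length_lt_of_mem_inside hI).ne' (h.length_eq 0)
    have hbottom {I : Set ℚ} (hI : I ⊆ v.range) : k ++ [v.bottom] ∉ inside k I := fun h0 ↦
      (hI (append_cons_mem_inside.1 h0)).1.false
    have hapex {I : Set ℚ} (hI : v.apex ∉ I) : k ++ [v.up.bottom] ∉ inside k I := fun h0 ↦
      hI (append_cons_mem_inside.1 h0)
    refine ⟨![c 0, k ++ [v.bottom], k ++ [v.up.bottom]], inside k v.leftSide.range,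
      inside k v.rightSide.range, ?_, .edge h 0 hv.leftSide,
      (IsRegion.edge h 0 hv.rightSide).reverse,
      disjoint_inside v.disjoint_range_leftSide_rightSide, ?_⟩
    · have h₀₁ := h.adj v.bottom 0
      have h₀₂ := h.adj v.up.bottom 0
      have h₁₂ : codeGraph.Adj (k ++ [v.bottom]) (k ++ [v.up.bottom]) := hv.leftSide.adj k
      simp [Pairwise, Fin.forall_fin_succ, h₀₁, h₀₂, h₁₂, h₀₁.symm, h₀₂.symm, h₁₂.symm]
    · simp [Fin.forall_fin_succ, hc, hbottom v.range_leftSide_subset,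
        hbottom v.range_rightSide_subset, hapex v.apex_notMem_range_leftSide,
        hapex v.apex_notMem_range_rightSide]

end PlanarThreeTree

theorem mainTheorem1 {V : Type u} (G : SimpleGraph V) (hG : G.IsPlanarThreeTree) :
    G.queueNumber ≤ 5 :=
  PlanarThreeTree.queueNumber_le_of_isContained
    (PlanarThreeTree.isContained_of_isPlanarThreeTree PlanarThreeTree.isStackingSystem_isRegion hG)
    PlanarThreeTree.nonempty_queueLayout_codeGraph
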